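/- **Conventions.** A linear threshold function (LTF) over $n$ bits is $\Phi=(w,\theta)$ with $w\in\mathbb{R}^n$, $\theta\in\mathbb{R}$, computing $x\mapsto\mathrm{sgn}(\langle w,x\rangle-\theta)$ on $\{-1,1\}^n$; it is represented so that $\langle w,x\rangle\neq\theta$ for every $x\in\{-1,1\}^n$. For a restriction $\rho\in\{-1,1,\star\}^n$ with set of alive variables $I=\{i:\rho_i=\star\}$ and fixed values $(\rho_i)_{i\notin I}$, the restricted LTF is $\Phi{\upharpoonright}_\rho=\bigl(w_I,\ \theta-\sum_{i\notin I}w_i\rho_i\bigr)$. An LTF $(w,\theta)$ is $t$-balanced if $|\theta|\le t\,\|w\|_2$. For $q,n\in\mathbb{N}$, a pair $y\in\{-1,1\}^{qn}$ ($n$ blocks of $q$ bits) and $z\in\{-1,1\}^n$ defines the restriction $\rho_{y,z}$ in which variable $i$ is alive if the $i$-th block of $y$ is all ones, and is fixed to $z_i$ otherwise. For distributions $\mathbf{y},\mathbf{z}$, $\rho\sim(\mathbf{y},\mathbf{z})$ denotes $\rho_{y,z}$ for independent $y\sim\mathbf{y}$, $z\sim\mathbf{z}$. A distribution over $\{-1,1\}^N$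 is $\delta$-almost $k$-wise independent if its marginal on every set of $\min(k,N)$ coordinates is $\delta$-close to uniform in statistical distance. A distribution $\mathbf{z}$ over $\{-1,1\}^n$ is $\varepsilon$-pseudorandomly concentrated if for all $w\in\mathbb{R}^n$ and reals $a<b$, $\bigl|\Pr[\langle w,\mathbf{z}\rangle\in[a,b]]-\Pr[\langle w,\mathbf{u}_n\rangle\in[a,b]]\bigr|\le\varepsilon$, where $\mathbf{u}_n$ is uniform over $\{-1,1\}^n$. **Proposition (pseudorandom restriction lemma for an arbitrary LTF).** For every $c\in\mathbb{N}$ there are constants $C_1,C_2>0$ and $K\in\mathbb{N}$, depending only on $c$, such that the following holds. Let $n\in\mathbb{N}$, let $p=2^{-q}$ with $q\in\mathbb{N}$ (so $q=\log_2(1/p)$), and let $0<t\le p^{-1/(3c-2)}$. Let $\mathbf{y}$ be a distribution over $\{-1,1\}^{qn}$ that is $p$-almost $k$-wise independent for some integer $k\ge q$ (in particular, any $k=O(\log(1/p))$ with $k\ge\log_2(1/p)$ is allowed), and let $\mathbf{z}$ be a distribution over $\{-1,1\}^n$ that is $\frac{1}{4t^c}$-pseudorandomly concentrated. Then for every LTF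 $\Phi$ over $n$ input bits, $$\Pr_{\rho\sim(\mathbf{y},\mathbf{z})}\bigl[\Phi{\upharpoonright}_\rho\text{ is }t\text{-balanced}\bigr]\ \le\ C_1\,t^{1+c/2}\,\bigl(\log(t+2)\bigr)^{K}\sqrt{p}+C_2\,t^{-c},$$ that is, the probability is at most $\tilde{O}(t^{1+c/2})\cdot\sqrt{p}+O(t^{-c})$. -/

import Mathlib

noncomputable section

namespace LTFRestriction

/-! Strings over the alphabet `{-1, 1}` indexed by `ι` are functions `ι → ℤˣ`. -/

/-- The probability of the event `s` under the distribution `μ`. -/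
def prob {α : Type*} (μ : PMF α) (s : Set α) : ℝ := (μ.toOuterMeasure s).toReal

/-- Statistical (total variation) distance of two distributions on a finite set. -/
def statDist {α : Type*} [Fintype α] (μ ν : PMF α) : ℝ :=
  (1 / 2) * ∑ a, |(μ a).toReal - (ν a).toReal|

/-- The uniform distribution on `{-1, 1}^ι`. -/
def unif (ι : Type*) [Fintype ι] [DecidableEq ι] : PMF (ι → ℤˣ) :=
  PMF.uniformOfFintype (ι → ℤˣ)

/-- `y` is `δ`-almost `k`-wise independent: its restriction to any `k` coordinates is `δ`-close
to uniform in statistical distance. (If there are fewer than `k` coordinates, this is required of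
all of them together, so that the notion is never vacuous.) -/
def AlmostWiseIndep {ι : Type*} [Fintype ι] [DecidableEq ι]
    (δ : ℝ) (k : ℕ) (y : PMF (ι → ℤˣ)) : Prop :=
  ∀ S : Finset ι, S.card = min k (Fintype.card ι) →
    statDist (y.map fun x (i : S) => x i) (unif S) ≤ δ

/-- The linear form `⟨w, x⟩` on `{-1, 1}^ι`. -/
def dot {ι : Type*} [Fintype ι] (w : EuclideanSpace ℝ ι) (x : ι → ℤˣ) : ℝ :=
  ∑ i, w i * ((x i : ℤ) : ℝ)

/-- `z` is `ε`-pseudorandomly concentrated. -/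
def PseudorandomlyConcentrated {ι : Type*} [Fintype ι] [DecidableEq ι]
    (ε : ℝ) (z : PMF (ι → ℤˣ)) : Prop :=
  ∀ (w : EuclideanSpace ℝ ι) (a b : ℝ), a < b →
    |prob z {x | dot w x ∈ Set.Icc a b} - prob (unif ι) {x | dot w x ∈ Set.Icc a b}| ≤ ε

/-- A linear threshold function `Φ = (w, θ)`, that is `x ↦ sgn (⟨w, x⟩ - θ)`, given by its weight
vector and its threshold. -/
structure LTF (ι : Type*) [Fintype ι] where
  /-- the weights -/
  w : EuclideanSpace ℝ ι
  /-- the threshold -/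
  θ : ℝ

/-- No point of the cube lies on the separating hyperplane, so that the sign of `⟨w, x⟩ - θ` is
`-1` or `1` at every `x`. -/
def LTF.Nondegenerate {ι : Type*} [Fintype ι] (Φ : LTF ι) : Prop :=
  ∀ x : ι → ℤˣ, dot Φ.w x ≠ Φ.θ

/-- `Φ` is `t`-balanced: `|θ| ≤ t * ‖w‖₂`. -/
def LTF.Balanced {ι : Type*} [Fintype ι] (t : ℝ) (Φ : LTF ι) : Prop :=
  |Φ.θ| ≤ t * ‖Φ.w‖

/-- A restriction `ρ ∈ {-1, 1, ⋆}^ι`; `none` is the symbol `⋆`, which marks the alive variables. -/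
abbrev Restriction (ι : Type*) := ι → Option ℤˣ

/-- The contribution of one variable of weight `a` to the sum over the fixed variables. -/
def fixedTerm (a : ℝ) : Option ℤˣ → ℝ
  | none => 0
  | some s => a * ((s : ℤ) : ℝ)

/-- The restricted function `Φ↾ρ`: with `I` the set of alive variables and `z` the values of the
fixed ones, it is the threshold function `(w_I, θ - ⟨w_{Iᶜ}, z⟩)` in the variables of `I`. -/
def LTF.restrict {ι : Type*} [Fintype ι] (Φ : LTF ι) (ρ : Restriction ι) :
    LTF {i : ι // ρ i = none} where
  w := WithLp.toLp 2 fun i => Φ.w i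
  θ := Φ.θ - ∑ i, fixedTerm (Φ.w i) (ρ i)

/-- The restriction `ρ_{y,z}` encoded by `y ∈ {-1, 1}^{n q}` (one block of `q` bits for each
variable) and `z ∈ {-1, 1}^n`: a variable stays alive if all bits of its block in `y` are `1`, and
is fixed to its value in `z` otherwise. -/
def toRestriction {n q : ℕ} (y : Fin n × Fin q → ℤˣ) (z : Fin n → ℤˣ) : Restriction (Fin n) :=
  fun i => if ∀ j, y (i, j) = 1 then none else some (z i)

/-- The distribution of `ρ_{y,z}` for independent samples `y`, `z` of the given distributions. -/
def restrictionDist {n q : ℕ} (y : PMF (Fin n × Fin q → ℤˣ)) (z : PMF (Fin n → ℤˣ)) :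
    PMF (Restriction (Fin n)) :=
  y.bind fun a => z.map fun b => toRestriction a b

end LTFRestriction

end

/-! With `I` the alive set, the restricted function is balanced iff the sum over the fixed variables
is within `t‖w_I‖` of `θ` (`balanced_restrict_iff`). For each fixed `y`, pseudorandom concentration
replaces `z` by uniform bits at cost `1 / (4 t^c)`, leaving a small ball estimate for `w` with `I`
zeroed.

Put `ε = t^{-c}`. `exists_head_tail` uses `w` alone, so independently of `y`, to split off a head of
about `t^{2c} log² t` coordinates. Some head coordinate is alive with probability at most `3p` times
its size, and the upper bound on `t` absorbs this into the `√p` term (`mul_pow_le_rpow_mul_sqrt`).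
Otherwise `I` lies in the tail `S`. If `S` is regular, a Fourier small ball estimate gives `O(ε +
t‖w_I‖/‖w_S‖)` (`prob_unif_zeroOn_le_of_regular`), and averaging over `y` with Jensen turns the
ratio into `O(√p)`. If not, the head contains `r` weights, each dominating what remains after its
round, and averaging over their signs gives `2^{-r} ≤ t^{-c}`. -/

namespace LTFRestriction

open Finset

/-! ### Finite probabilities as sums -/

section Probability

variable {α β : Type*} [Fintype α]

open Classical in
lemma prob_eq_sum (μ : PMF α) (s : Set α) :
    prob μ s = ∑ a, if a ∈ s then (μ a).toReal else 0 := by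
  rw [prob, PMF.toOuterMeasure_apply_fintype, ENNReal.toReal_sum]
  · refine sum_congr rfl fun a _ => ?_
    by_cases h : a ∈ s <;> simp [h]
  · intro a _
    by_cases h : a ∈ s <;> simp [h, μ.apply_ne_top]

lemma sum_toReal (μ : PMF α) : ∑ a, (μ a).toReal = 1 := by
  rw [← ENNReal.toReal_sum fun a _ => μ.apply_ne_top a, ← tsum_fintype (L := .unconditional α),
    μ.tsum_coe, ENNReal.toReal_one]

lemma prob_le_one (μ : PMF α) (s : Set α) : prob μ s ≤ 1 := by
  classical
  rw [prob_eq_sum, ← sum_toReal μ]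
  refine sum_le_sum fun a _ => ?_
  split_ifs <;> simp

lemma prob_bind_map [Fintype β] {γ : Type*} (μ : PMF α) (ν : PMF β) (f : α → β → γ) (s : Set γ) :
    prob (μ.bind fun a => ν.map (f a)) s = ∑ a, (μ a).toReal * prob ν {b | f a b ∈ s} := by
  rw [prob, PMF.toOuterMeasure_bind_apply, tsum_fintype, ENNReal.toReal_sum]
  · refine sum_congr rfl fun a _ => ?_
    rw [ENNReal.toReal_mul, PMF.toOuterMeasure_map_apply]
    rfl
  · intro a _
    refine ENNReal.mul_ne_top (μ.apply_ne_top a) ?_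
    rw [PMF.toOuterMeasure_map_apply, PMF.toOuterMeasure_apply_fintype]
    refine ENNReal.sum_ne_top.2 fun b _ => ?_
    by_cases h : b ∈ f a ⁻¹' s <;> simp [Set.indicator, h, ν.apply_ne_top]

lemma prob_map {α γ : Type*} (μ : PMF α) (f : α → γ) (s : Set γ) :
    prob (μ.map f) s = prob μ (f ⁻¹' s) := by
  rw [prob, PMF.toOuterMeasure_map_apply, prob]

/-- The factor 2 is not sharp: comparing pointwise ignores that positive and negative deviations
balance. Only the constant suffers. -/
lemma prob_le_add_statDist (μ ν : PMF α) (s : Set α) : prob μ s ≤ prob ν s + 2 * statDist μ ν := by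
  classical
  rw [prob_eq_sum, prob_eq_sum, statDist, ← mul_assoc]
  norm_num
  rw [← sum_add_distrib]
  refine sum_le_sum fun a _ => ?_
  split_ifs
  · linarith [le_abs_self ((μ a).toReal - (ν a).toReal)]
  · simp

end Probability

/-! ### Uniform and almost independent bits -/

section Uniform

variable {ι : Type*} [Fintype ι] [DecidableEq ι]

open Classical in
lemma prob_unif (s : Set (ι → ℤˣ)) :
    prob (unif ι) s = (∑ x, if x ∈ s then (1 : ℝ) else 0) / 2 ^ Fintype.card ι := by
  rw [prob_eq_sum, sum_div]
  refine sum_congr rfl fun x _ => ?_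
  split_ifs
  · simp [unif]
  · simp

lemma prob_unif_coe (s : Finset (ι → ℤˣ)) :
    prob (unif ι) s = s.card / 2 ^ Fintype.card ι := by
  classical
  rw [prob_unif]
  simp

/-- The uniform probability that all bits in `B` are `1`. -/
lemma prob_unif_forall_eq_one (B : Finset ι) :
    prob (unif ι) {x | ∀ i ∈ B, x i = 1} = 1 / 2 ^ B.card := by
  classical
  have h : {x : ι → ℤˣ | ∀ i ∈ B, x i = 1} =
      (Fintype.piFinset fun i => if i ∈ B then {1} else univ : Finset (ι → ℤˣ)) := by
    ext x
    simp only [Set.mem_ofPred_eq, mem_coe, Fintype.mem_piFinset]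
    refine forall_congr' fun i => ?_
    by_cases hi : i ∈ B <;> simp only [hi, if_true, if_false, mem_singleton, mem_univ,
      true_imp_iff, false_imp_iff]
  have h2 : ∀ i, (if i ∈ B then ({1} : Finset ℤˣ) else univ).card = if i ∈ B then 1 else 2 := by
    intro i
    by_cases hi : i ∈ B <;> simp [hi]
  rw [h, prob_unif_coe, Fintype.card_piFinset]
  simp_rw [h2]
  rw [prod_ite, prod_const_one, one_mul, prod_const]
  have h3 : (univ.filter fun i => i ∉ B).card + B.card = Fintype.card ι := by
    rw [← card_compl_add_card B]; congr 2; ext; simp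
  rw [← h3, pow_add]
  push_cast
  field_simp

/-- In an almost `k`-wise independent string, a set of at most `k` bits is all ones with
probability not much larger than under the uniform distribution. -/
lemma AlmostWiseIndep.prob_forall_eq_one_le {δ : ℝ} {k : ℕ} {y : PMF (ι → ℤˣ)}
    (hy : AlmostWiseIndep δ k y) (B : Finset ι) (hB : B.card ≤ k) :
    prob y {x | ∀ i ∈ B, x i = 1} ≤ 1 / 2 ^ B.card + 2 * δ := by
  classical
  -- Almost independence speaks only of sets of exactly `min k (card ι)` coordinates, so `B` is
  -- padded to one.
  obtain ⟨S, hBS, hS⟩ := exists_superset_card_eq (s := B) (n := min k (Fintype.card ι))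
    (le_min hB (card_le_univ B)) (min_le_right _ _)
  set B' : Finset S := univ.filter fun i : S => (i : ι) ∈ B with hB'
  have hcard : B'.card = B.card := by
    rw [← card_map (Function.Embedding.subtype _)]
    congr 1
    ext i
    simp only [hB', mem_map, mem_filter, mem_univ, true_and, Function.Embedding.subtype_apply,
      Subtype.exists, exists_and_right, exists_eq_right]
    exact ⟨fun h => by simpa using h.2, fun h => ⟨hBS h, by simpa using h⟩⟩
  have h1 : prob y {x | ∀ i ∈ B, x i = 1} =
      prob (y.map fun x (i : S) => x i) {x | ∀ i ∈ B', x i = 1} := by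
    rw [prob_map]
    congr 1
    ext x
    simp only [Set.mem_ofPred_eq, Set.mem_preimage, hB', mem_filter, mem_univ, true_and,
      Subtype.forall]
    exact ⟨fun h a _ hb => h a hb, fun h a hb => h a (hBS hb) hb⟩
  rw [h1, ← hcard, ← prob_unif_forall_eq_one B']
  have := prob_le_add_statDist (y.map fun x (i : S) => x i) (unif S) {x | ∀ i ∈ B', x i = 1}
  linarith [hy S hS]

end Uniform

/-! ### Small ball estimate by Fourier analysis -/

section SmallBall

/-- A kernel with compactly supported Fourier transform. -/
lemma integral_one_sub_mul_cos {x : ℝ} (hx : x ≠ 0) :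
    ∫ ξ in (0 : ℝ)..1, (1 - ξ) * Real.cos (ξ * x) = (1 - Real.cos x) / x ^ 2 := by
  have h : ∀ ξ ∈ Set.uIcc (0 : ℝ) 1, HasDerivAt
      (fun ξ => (1 - ξ) * (Real.sin (ξ * x) / x) - Real.cos (ξ * x) / x ^ 2)
      ((1 - ξ) * Real.cos (ξ * x)) ξ := by
    intro ξ _
    have h1 : HasDerivAt (fun ξ : ℝ => ξ * x) x ξ := by simpa using (hasDerivAt_id ξ).mul_const x
    have h2 := ((hasDerivAt_id ξ).const_sub 1).mul (h1.sin.div_const x)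
    refine (h2.sub (h1.cos.div_const (x ^ 2))).congr_deriv ?_
    simp only [id]
    field_simp
    ring
  rw [intervalIntegral.integral_eq_sub_of_hasDerivAt h (by
    apply Continuous.intervalIntegrable; fun_prop)]
  simp
  ring

lemma integral_one_sub_mul_cos_nonneg (x : ℝ) :
    0 ≤ ∫ ξ in (0 : ℝ)..1, (1 - ξ) * Real.cos (ξ * x) := by
  by_cases hx : x = 0
  · subst hx
    refine intervalIntegral.integral_nonneg zero_le_one fun ξ hξ => ?_
    simpa using hξ.2
  · rw [integral_one_sub_mul_cos hx]
    exact div_nonneg (by linarith [Real.cos_le_one x]) (sq_nonneg x)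

/-- Here the cosine is at least `1/2` throughout. With nonnegativity elsewhere, four times the
kernel majorises the indicator of `[-1, 1]`. -/
lemma one_le_four_mul_integral_one_sub_mul_cos {x : ℝ} (hx : |x| ≤ 1) :
    1 ≤ 4 * ∫ ξ in (0 : ℝ)..1, (1 - ξ) * Real.cos (ξ * x) := by
  have h : ∫ ξ in (0 : ℝ)..1, (1 - ξ) * (1 / 2) ≤
      ∫ ξ in (0 : ℝ)..1, (1 - ξ) * Real.cos (ξ * x) := by
    refine intervalIntegral.integral_mono_on zero_le_one
      (by apply Continuous.intervalIntegrable; fun_prop)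
      (by apply Continuous.intervalIntegrable; fun_prop) fun ξ hξ => ?_
    refine mul_le_mul_of_nonneg_left ?_ (by linarith [hξ.2])
    have h1 : (ξ * x) ^ 2 ≤ 1 := by
      rw [sq_le_one_iff_abs_le_one, abs_mul, abs_of_nonneg hξ.1]
      exact mul_le_one₀ hξ.2 (abs_nonneg x) hx
    linarith [Real.one_sub_sq_div_two_le_cos (x := ξ * x)]
  have h2 : ∫ ξ in (0 : ℝ)..1, (1 - ξ) * (1 / 2) = 1 / 4 := by
    rw [intervalIntegral.integral_mul_const, intervalIntegral.integral_sub (by simp) (by simp)]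
    simp
    norm_num
  linarith

lemma abs_cos_le_exp {x : ℝ} (hx : |x| ≤ 1) : |Real.cos x| ≤ Real.exp (-(x ^ 2 / 8)) := by
  have hpi := Real.pi_gt_three
  have h4 := Real.pi_le_four
  have h1 : 0 ≤ Real.cos x :=
    Real.cos_nonneg_of_neg_pi_div_two_le_of_le (by linarith [(abs_le.1 hx).1])
      (by linarith [(abs_le.1 hx).2])
  rw [abs_of_nonneg h1]
  have h3 : Real.cos x ≤ 1 - 2 / Real.pi ^ 2 * x ^ 2 :=
    Real.cos_le_one_sub_mul_cos_sq (by linarith)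
  have h5 : 1 / 8 ≤ 2 / Real.pi ^ 2 := by
    rw [div_le_div_iff₀ (by norm_num) (by positivity)]
    nlinarith
  have h6 := mul_le_mul_of_nonneg_right h5 (sq_nonneg x)
  linarith [Real.add_one_le_exp (-(x ^ 2 / 8))]

variable {ι : Type*} [Fintype ι] [DecidableEq ι]

/-- The characteristic function of a sum of independent signs is a product of cosines; being real,
it leaves only `cos b` from the phase. -/
lemma sum_cos (a : ι → ℝ) (b : ℝ) :
    ∑ x : ι → ℤˣ, Real.cos (∑ i, a i * ((x i : ℤ) : ℝ) - b) =
      2 ^ Fintype.card ι * ((∏ i, Real.cos (a i)) * Real.cos b) := by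
  have h1 : ∀ x : ι → ℤˣ, Real.cos (∑ i, a i * ((x i : ℤ) : ℝ) - b) =
      (Complex.exp (-(b * Complex.I)) *
        ∏ i, Complex.exp ((a i * ((x i : ℤ) : ℝ) : ℝ) * Complex.I)).re := by
    intro x
    rw [← Complex.exp_sum, ← Complex.exp_add, ← Complex.exp_ofReal_mul_I_re]
    congr 2
    push_cast
    rw [sub_mul, sum_mul]
    ring
  have h2 : ∏ i, ((2 : ℂ) * Real.cos (a i)) = ∑ x : ι → ℤˣ,
      ∏ i, Complex.exp ((a i * ((x i : ℤ) : ℝ) : ℝ) * Complex.I) := by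
    rw [← Fintype.piFinset_univ, ← prod_univ_sum (fun _ : ι => (univ : Finset ℤˣ))
      (fun i s => Complex.exp ((a i * ((s : ℤ) : ℝ) : ℝ) * Complex.I))]
    refine prod_congr rfl fun i _ => ?_
    have : (univ : Finset ℤˣ) = {1, -1} := rfl
    rw [this, sum_pair (by decide)]
    push_cast
    rw [Complex.two_cos]
    simp
  simp_rw [h1]
  rw [← Complex.re_sum, ← mul_sum, ← h2, prod_mul_distrib, prod_const, card_univ]
  have h3 : Complex.exp (-(b * Complex.I)) * (2 ^ Fintype.card ι * ∏ i, (Real.cos (a i) : ℂ)) =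
      ((2 ^ Fintype.card ι * ∏ i, Real.cos (a i) : ℝ) : ℂ) *
        Complex.exp ((-b : ℝ) * Complex.I) := by
    push_cast
    rw [neg_mul]
    ring
  rw [h3, Complex.re_ofReal_mul, Complex.exp_ofReal_mul_I_re, Real.cos_neg]
  ring

/-- A small ball estimate for sums of independent signs, in terms of any part of the weights which
is not concentrated on few coordinates. -/
lemma prob_unif_abs_dot_sub_le (v : EuclideanSpace ℝ ι) (T : Finset ι) {s R : ℝ} (θ : ℝ)
    (hs : 0 < s) (hR : R ≤ s) (hv : ∀ i ∈ T, |v i| ≤ s) (hA : 0 < ∑ i ∈ T, v i ^ 2) :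
    prob (unif ι) {x | |dot v x - θ| ≤ R} ≤ 12 * (s / √(∑ i ∈ T, v i ^ 2)) := by
  classical
  set A := ∑ i ∈ T, v i ^ 2 with hAdef
  set N : ℝ := 2 ^ Fintype.card ι with hN
  have hN0 : 0 < N := by positivity
  have h1 : ∀ x : ι → ℤˣ, (if x ∈ {x | |dot v x - θ| ≤ R} then (1 : ℝ) else 0) ≤
      4 * ∫ ξ in (0 : ℝ)..1, (1 - ξ) * Real.cos (ξ * ((dot v x - θ) / s)) := by
    intro x
    split_ifs with h
    · refine one_le_four_mul_integral_one_sub_mul_cos ?_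
      rw [abs_div, abs_of_pos hs, div_le_one hs]
      exact le_trans h hR
    · exact mul_nonneg (by norm_num) (integral_one_sub_mul_cos_nonneg _)
  have h2 : ∑ x : ι → ℤˣ, ∫ ξ in (0 : ℝ)..1, (1 - ξ) * Real.cos (ξ * ((dot v x - θ) / s)) =
      ∫ ξ in (0 : ℝ)..1, (1 - ξ) * (N * ((∏ i, Real.cos (ξ * v i / s)) *
        Real.cos (ξ * θ / s))) := by
    rw [← intervalIntegral.integral_finsetSum]
    · refine intervalIntegral.integral_congr fun ξ _ => ?_
      simp only
      rw [← mul_sum, ← sum_cos]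
      congr 1
      refine sum_congr rfl fun x _ => ?_
      congr 1
      rw [dot, sub_div, mul_sub, sum_div, mul_sum]
      congr 1
      · exact sum_congr rfl fun i _ => by ring
      · ring
    · intro x _
      apply Continuous.intervalIntegrable
      fun_prop
  -- Cosines outside `T` are bounded by 1, so weights there may be arbitrary; those in `T` have
  -- arguments in `[-1, 1]` and decay like a Gaussian.
  have h3 : ∫ ξ in (0 : ℝ)..1, (1 - ξ) * (N * ((∏ i, Real.cos (ξ * v i / s)) *
        Real.cos (ξ * θ / s))) ≤ ∫ ξ in (0 : ℝ)..1, N * Real.exp (-(A / s ^ 2 / 8) * ξ ^ 2) := by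
    refine intervalIntegral.integral_mono_on zero_le_one
      (by apply Continuous.intervalIntegrable; fun_prop)
      (by apply Continuous.intervalIntegrable; fun_prop) fun ξ hξ => ?_
    rw [mul_left_comm]
    refine mul_le_mul_of_nonneg_left ?_ hN0.le
    refine (le_abs_self _).trans ?_
    rw [abs_mul, abs_mul, abs_of_nonneg (sub_nonneg.2 hξ.2)]
    have e1 : |∏ i, Real.cos (ξ * v i / s)| ≤ Real.exp (-(A / s ^ 2 / 8) * ξ ^ 2) := by
      rw [abs_prod]
      calc ∏ i, |Real.cos (ξ * v i / s)| ≤ ∏ i ∈ T, |Real.cos (ξ * v i / s)| :=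
            prod_le_prod_of_subset_of_le_one (subset_univ T) (fun i _ => abs_nonneg _)
              fun i _ _ => Real.abs_cos_le_one _
        _ ≤ ∏ i ∈ T, Real.exp (-((ξ * v i / s) ^ 2 / 8)) := by
            refine prod_le_prod (fun i _ => abs_nonneg _) fun i hi => abs_cos_le_exp ?_
            rw [abs_div, abs_of_pos hs, div_le_one hs, abs_mul, abs_of_nonneg hξ.1]
            exact (mul_le_of_le_one_left (abs_nonneg _) hξ.2).trans (hv i hi)
        _ = Real.exp (-(A / s ^ 2 / 8) * ξ ^ 2) := by
            rw [← Real.exp_sum]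
            congr 1
            rw [hAdef, sum_div, sum_div, ← sum_neg_distrib, sum_mul]
            exact sum_congr rfl fun i _ => by ring
    calc (1 - ξ) * (|∏ i, Real.cos (ξ * v i / s)| * |Real.cos (ξ * θ / s)|)
        ≤ 1 * (Real.exp (-(A / s ^ 2 / 8) * ξ ^ 2) * 1) := by
          refine mul_le_mul (by linarith [hξ.1]) (mul_le_mul e1 (Real.abs_cos_le_one _)
            (abs_nonneg _) (Real.exp_nonneg _)) (by positivity) zero_le_one
      _ = _ := by ring
  have hb : 0 < A / s ^ 2 / 8 := by positivity
  have h4 : ∫ ξ in (0 : ℝ)..1, Real.exp (-(A / s ^ 2 / 8) * ξ ^ 2) ≤ 3 * (s / √A) := by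
    rw [intervalIntegral.integral_of_le zero_le_one]
    calc ∫ ξ in Set.Ioc (0 : ℝ) 1, Real.exp (-(A / s ^ 2 / 8) * ξ ^ 2)
        ≤ ∫ ξ in Set.Ioi (0 : ℝ), Real.exp (-(A / s ^ 2 / 8) * ξ ^ 2) :=
          MeasureTheory.setIntegral_mono_set (integrable_exp_neg_mul_sq hb).integrableOn
            (Filter.Eventually.of_forall fun ξ => Real.exp_nonneg _)
            Set.Ioc_subset_Ioi_self.eventuallyLE
      _ = √(Real.pi / (A / s ^ 2 / 8)) / 2 := integral_gaussian_Ioi _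
      -- `8π ≤ 32`, rounded up to a perfect square.
      _ ≤ √(6 ^ 2 * (s ^ 2 / A)) / 2 := by
          gcongr
          rw [show Real.pi / (A / s ^ 2 / 8) = (8 * Real.pi) * (s ^ 2 / A) by field_simp]
          gcongr
          linarith [Real.pi_le_four]
      _ = 3 * (s / √A) := by
          rw [Real.sqrt_mul (by positivity), Real.sqrt_sq (by norm_num), Real.sqrt_div (sq_nonneg s),
            Real.sqrt_sq hs.le]
          ring
  rw [prob_unif, div_le_iff₀ hN0]
  calc _ ≤ ∑ x : ι → ℤˣ,
          4 * ∫ ξ in (0 : ℝ)..1, (1 - ξ) * Real.cos (ξ * ((dot v x - θ) / s)) :=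
        sum_le_sum fun x _ => h1 x
    _ ≤ 4 * ∫ ξ in (0 : ℝ)..1, N * Real.exp (-(A / s ^ 2 / 8) * ξ ^ 2) := by
        rw [← mul_sum, h2]
        linarith
    _ ≤ 4 * (N * (3 * (s / √A))) := by
        rw [intervalIntegral.integral_const_mul]
        gcongr
    _ = _ := by ring

end SmallBall

/-! ### Head and tail of the weight vector -/

section HeadTail

variable {ι : Type*} [Fintype ι] [DecidableEq ι]

/-- The weight vector `w` with the coordinates in `I` replaced by zero. -/
def zeroOn (w : EuclideanSpace ℝ ι) (I : Finset ι) : EuclideanSpace ℝ ι :=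
  WithLp.toLp 2 fun i => if i ∈ I then 0 else w i

omit [Fintype ι] in
lemma zeroOn_apply (w : EuclideanSpace ℝ ι) (I : Finset ι) (i : ι) :
    zeroOn w I i = if i ∈ I then 0 else w i := rfl

/-- The squared Euclidean norm of the part of `w` in `S`. -/
def sqSum (w : EuclideanSpace ℝ ι) (S : Finset ι) : ℝ := ∑ i ∈ S, w i ^ 2

omit [Fintype ι] [DecidableEq ι] in
lemma sqSum_nonneg (w : EuclideanSpace ℝ ι) (S : Finset ι) : 0 ≤ sqSum w S :=
  sum_nonneg fun _ _ => sq_nonneg _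

omit [Fintype ι] [DecidableEq ι] in
lemma sqSum_mono (w : EuclideanSpace ℝ ι) {S T : Finset ι} (h : S ⊆ T) : sqSum w S ≤ sqSum w T :=
  sum_le_sum_of_subset_of_nonneg h fun _ _ _ => sq_nonneg _

/-- No weight in `S` carries more than the fraction `e` of the squared norm. -/
def Regular (e : ℝ) (w : EuclideanSpace ℝ ι) (S : Finset ι) : Prop :=
  ∀ i ∈ S, w i ^ 2 ≤ e * sqSum w S

/-- Averaging over the sign of a heavy coordinate halves the small ball probability. -/
lemma prob_unif_abs_dot_sub_le_half (v : EuclideanSpace ℝ ι) (i : ι) (θ : ℝ) {R : ℝ}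
    (hR : R < |v i|) :
    prob (unif ι) {x | |dot v x - θ| ≤ R} ≤
      1 / 2 * prob (unif ι) {x | |dot (zeroOn v {i}) x - θ| ≤ R + |v i|} := by
  classical
  set v' := zeroOn v {i} with hv'
  have hdot : ∀ x : ι → ℤˣ, dot v x = dot v' x + v i * ((x i : ℤ) : ℝ) := by
    intro x
    rw [dot, dot, ← add_sum_erase univ _ (mem_univ i), ← add_sum_erase univ _ (mem_univ i), hv',
      zeroOn_apply]
    have : ∑ j ∈ univ.erase i, zeroOn v {i} j * ((x j : ℤ) : ℝ) =
        ∑ j ∈ univ.erase i, v j * ((x j : ℤ) : ℝ) :=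
      sum_congr rfl fun j hj => by simp [zeroOn_apply, ne_of_mem_erase hj]
    rw [this]
    simp
  set f : (ι → ℤˣ) → (ι → ℤˣ) := fun x => Function.update x i (-x i) with hf
  have hinv : Function.Involutive f := by
    intro x
    simp [hf]
  have hdot' : ∀ x, dot v' (f x) = dot v' x := by
    intro x
    refine sum_congr rfl fun j _ => ?_
    by_cases hj : j = i
    · simp [hv', zeroOn_apply, hj]
    · simp [hf, hj]
  have habs : ∀ x : ι → ℤˣ, v i * ((x i : ℤ) : ℝ) = v i ∨ v i * ((x i : ℤ) : ℝ) = - v i := by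
    intro x
    rcases Int.units_eq_one_or (x i) with h | h <;> simp [h]
  have hfi : ∀ x : ι → ℤˣ, v i * ((f x i : ℤ) : ℝ) = - (v i * ((x i : ℤ) : ℝ)) := by
    intro x
    simp [hf]
  set E : Set (ι → ℤˣ) := {x | |dot v x - θ| ≤ R} with hE
  set E' : Set (ι → ℤˣ) := {x | |dot v' x - θ| ≤ R + |v i|} with hE'
  -- The values at `x` and `f x` differ by `2|v i| > 2R`, so at most one lies in the small ball; if
  -- one does, the sum without `i` lies in the wider ball.
  have hkey : ∀ x, (if x ∈ E then (1 : ℝ) else 0) + (if f x ∈ E then (1 : ℝ) else 0) ≤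
      if x ∈ E' then (1 : ℝ) else 0 := by
    intro x
    have a1 : x ∈ E ↔ |dot v' x + v i * ((x i : ℤ) : ℝ) - θ| ≤ R := by
      rw [← hdot]; rfl
    have a2 : f x ∈ E ↔ |dot v' x - v i * ((x i : ℤ) : ℝ) - θ| ≤ R := by
      rw [sub_eq_add_neg (dot v' x), ← hfi, ← hdot' x, ← hdot]; rfl
    have b : |v i * ((x i : ℤ) : ℝ)| = |v i| := by
      rcases habs x with h | h <;> simp [h]
    have h3 : x ∈ E' ↔ |dot v' x - θ| ≤ R + |v i * ((x i : ℤ) : ℝ)| := by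
      rw [b]; rfl
    rw [← b] at hR
    generalize v i * ((x i : ℤ) : ℝ) = a at *
    by_cases h1 : x ∈ E
    · have h4 : f x ∉ E := by
        rw [a2]
        rw [a1] at h1
        intro h2
        have : |2 * a| ≤ R + R := by
          rw [show 2 * a = (dot v' x + a - θ) - (dot v' x - a - θ) by ring]
          exact (abs_sub _ _).trans (add_le_add h1 h2)
        rw [abs_mul, abs_two] at this
        linarith
      have h5 : x ∈ E' := by
        rw [h3]
        rw [a1] at h1
        rw [show dot v' x - θ = (dot v' x + a - θ) - a by ring]
        exact (abs_sub _ _).trans (by linarith)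
      simp [h1, h4, h5]
    · by_cases h2 : f x ∈ E
      · have h5 : x ∈ E' := by
          rw [h3]
          rw [a2] at h2
          rw [show dot v' x - θ = (dot v' x - a - θ) + a by ring]
          exact (abs_add_le _ _).trans (by linarith)
        simp [h1, h2, h5]
      · simp only [h1, h2, if_false]
        split_ifs <;> simp
  have hsum : ∑ x, (if f x ∈ E then (1 : ℝ) else 0) = ∑ x, if x ∈ E then (1 : ℝ) else 0 :=
    Equiv.sum_comp (hinv.toPerm f) fun x => if x ∈ E then (1 : ℝ) else 0
  have := sum_le_sum fun x (_ : x ∈ univ) => hkey x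
  rw [sum_add_distrib, hsum] at this
  rw [prob_unif, prob_unif, ← mul_div_assoc]
  gcongr
  linarith

omit [Fintype ι] in
/-- Removing `m` heavy coordinates makes the remaining weights regular or shrinks their norm. -/
lemma exists_regular_or_sqSum_le (w : EuclideanSpace ℝ ι) {e : ℝ} (he : e ≤ 1) (S : Finset ι)
    (m : ℕ) : ∃ T ⊆ S, (S \ T).card ≤ m ∧ (Regular e w T ∨ sqSum w T ≤ (1 - e) ^ m * sqSum w S) := by
  induction m with
  | zero => exact ⟨S, Subset.rfl, by simp, Or.inr (by simp)⟩
  | succ m ih =>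
    obtain ⟨T, hTS, hcard, hT⟩ := ih
    by_cases hreg : Regular e w T
    · exact ⟨T, hTS, by omega, Or.inl hreg⟩
    have hT := hT.resolve_left hreg
    simp only [Regular, not_forall, not_le] at hreg
    obtain ⟨i, hi, hwi⟩ := hreg
    refine ⟨T.erase i, (erase_subset _ _).trans hTS, ?_, Or.inr ?_⟩
    · have : S \ T.erase i ⊆ insert i (S \ T) := by
        intro j
        simp only [mem_sdiff, mem_erase, mem_insert]
        tauto
      exact (card_le_card this).trans ((card_insert_le _ _).trans (by omega))
    · have h1 : sqSum w (T.erase i) + w i ^ 2 = sqSum w T := sum_erase_add _ _ hi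
      rw [pow_succ, mul_right_comm]
      have := mul_le_mul_of_nonneg_right hT (sub_nonneg.2 he)
      linarith

/-- Either a regular tail remains after removing few coordinates, or every weight vector agreeing
with `w` on the removed coordinates is anticoncentrated at the scale of the norm of the tail. -/
lemma exists_head_tail (w : EuclideanSpace ℝ ι) {e t : ℝ} (he : e ≤ 1) (ht : 1 ≤ t) {m : ℕ}
    (hm : 4 * t ^ 2 * (1 - e) ^ m ≤ e) (r : ℕ) :
    ∃ S : Finset ι, Sᶜ.card ≤ r * (m + 1) ∧ (Regular e w S ∨
      ∀ v : EuclideanSpace ℝ ι, (∀ i ∉ S, v i = w i) → ∀ θ R : ℝ, R ≤ 2 * t * √(sqSum w S) →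
        prob (unif ι) {x | |dot v x - θ| ≤ R} ≤ (1 / 2) ^ r) := by
  induction r with
  | zero => exact ⟨univ, by simp, Or.inr fun v _ θ R _ => by simpa using prob_le_one _ _⟩
  | succ r ih =>
    obtain ⟨S, hcard, hS⟩ := ih
    by_cases hreg : Regular e w S
    · exact ⟨S, hcard.trans (Nat.mul_le_mul_right _ (by omega)), Or.inl hreg⟩
    have hS := hS.resolve_left hreg
    simp only [Regular, not_forall, not_le] at hreg
    obtain ⟨i, hi, hwi⟩ := hreg
    obtain ⟨T, hTS, hTcard, hT⟩ := exists_regular_or_sqSum_le w he (S.erase i) m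
    refine ⟨T, ?_, ?_⟩
    · have : Tᶜ ⊆ Sᶜ ∪ insert i (S.erase i \ T) := by
        intro j
        simp only [mem_compl, mem_union, mem_insert, mem_sdiff, mem_erase]
        tauto
      have h1 := (card_le_card this).trans (card_union_le _ _)
      have h2 := card_insert_le i (S.erase i \ T)
      rw [Nat.succ_mul]
      omega
    · refine hT.imp_right fun hT v hv θ R hR => ?_
      have hiT : i ∉ T := fun h => (mem_erase.1 (hTS h)).1 rfl
      -- `m` removals shrink the squared norm by `(1 - e)^m`, enough by `hm` for the irregular
      -- weight `w i` to dominate. It is itself removed too, hence `m + 1` per round.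
      have hsmall : 2 * t * √(sqSum w T) < |w i| := by
        rw [← Real.sqrt_sq_eq_abs, show 2 * t = √((2 * t) ^ 2) from (Real.sqrt_sq (by linarith)).symm,
          ← Real.sqrt_mul (sq_nonneg _)]
        refine Real.sqrt_lt_sqrt (mul_nonneg (sq_nonneg _) (sqSum_nonneg _ _)) ?_
        calc (2 * t) ^ 2 * sqSum w T ≤ (2 * t) ^ 2 * ((1 - e) ^ m * sqSum w S) := by
              gcongr
              refine hT.trans ?_
              have := pow_nonneg (sub_nonneg.2 he) m
              gcongr
              exact sqSum_mono w (erase_subset _ _)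
          _ = (4 * t ^ 2 * (1 - e) ^ m) * sqSum w S := by ring
          _ ≤ e * sqSum w S := mul_le_mul_of_nonneg_right hm (sqSum_nonneg _ _)
          _ < w i ^ 2 := hwi
      have hle : |w i| ≤ √(sqSum w S) := by
        rw [← Real.sqrt_sq_eq_abs]
        exact Real.sqrt_le_sqrt (single_le_sum (f := fun i => w i ^ 2)
          (fun _ _ => sq_nonneg _) hi)
      have hvi := hv i hiT
      have h1 := prob_unif_abs_dot_sub_le_half v i θ (R := R) (by rw [hvi]; linarith)
      -- Quantifying over all `v` agreeing with `w` off `S` permits zeroing `i` here. The factor 2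
      -- in the scale closes the induction: `R + |w i| ≤ 2|w i| ≤ 2t‖w_S‖`.
      have h2 := hS (zeroOn v {i}) (fun j hj => by
        have hji : j ≠ i := fun h => hj (h ▸ hi)
        rw [zeroOn_apply, if_neg (by simpa using hji)]
        exact hv j fun h => hj (erase_subset _ _ (hTS h))) θ (R + |v i|) (by
          rw [hvi]
          nlinarith [Real.sqrt_nonneg (sqSum w S)])
      rw [pow_succ]
      linarith

/-- Anticoncentration after deleting the coordinates in a part `I` of a regular tail `S`, at the
scale of the norm of the deleted part. -/
lemma prob_unif_zeroOn_le_of_regular (w : EuclideanSpace ℝ ι) {ε t : ℝ} (hε : 0 ≤ ε) (ht : 1 ≤ t)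
    {S I : Finset ι} (hS : Regular (ε ^ 2) w S) (hI : I ⊆ S) (hI0 : 0 < sqSum w I) (θ : ℝ) :
    prob (unif ι) {x | |dot (zeroOn w I) x - θ| ≤ t * √(sqSum w I)} ≤
      24 * (ε + t * (√(sqSum w I) / √(sqSum w S))) := by
  have hS0 : 0 < sqSum w S := hI0.trans_le (sqSum_mono w hI)
  have hI1 := Real.sqrt_pos.2 hI0
  have hS1 := Real.sqrt_pos.2 hS0
  -- If `I` carries at least a quarter of the squared norm, the claimed bound exceeds 1.
  by_cases hhalf : sqSum w S ≤ 4 * sqSum w I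
  · refine (prob_le_one _ _).trans ?_
    have h1 : √(sqSum w S) ≤ 2 * √(sqSum w I) := by
      rw [show (2 : ℝ) = √(2 ^ 2) from (Real.sqrt_sq (by norm_num)).symm,
        ← Real.sqrt_mul (by norm_num)]
      exact Real.sqrt_le_sqrt (by linarith)
    have h2 : 1 / 2 ≤ √(sqSum w I) / √(sqSum w S) := by
      rw [le_div_iff₀ hS1]
      linarith
    nlinarith
  · have hsum : ∑ i ∈ S \ I, zeroOn w I i ^ 2 = sqSum w (S \ I) :=
      sum_congr rfl fun i hi => by rw [zeroOn_apply, if_neg (mem_sdiff.1 hi).2]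
    have hsub : sqSum w (S \ I) + sqSum w I = sqSum w S := sum_sdiff hI
    have hpos : 0 < sqSum w (S \ I) := by linarith
    -- This scale dominates both the regular weights and the radius.
    have hs : 0 < ε * √(sqSum w S) + t * √(sqSum w I) := by positivity
    have h1 := prob_unif_abs_dot_sub_le (zeroOn w I) (S \ I) (R := t * √(sqSum w I)) θ hs
      (by linarith [mul_nonneg hε hS1.le]) (fun i hi => by
        rw [zeroOn_apply, if_neg (mem_sdiff.1 hi).2]
        have h2 : |w i| ≤ ε * √(sqSum w S) := by
          rw [← Real.sqrt_sq_eq_abs, show ε * √(sqSum w S) = √(ε ^ 2 * sqSum w S) by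
            rw [Real.sqrt_mul (sq_nonneg _), Real.sqrt_sq hε]]
          exact Real.sqrt_le_sqrt (hS i (mem_sdiff.1 hi).1)
        have : 0 ≤ t * √(sqSum w I) := by positivity
        linarith) (by rwa [hsum])
    rw [hsum] at h1
    have h3 : √(sqSum w S) ≤ 2 * √(sqSum w (S \ I)) := by
      rw [show (2 : ℝ) = √(2 ^ 2) from (Real.sqrt_sq (by norm_num)).symm,
        ← Real.sqrt_mul (by norm_num)]
      exact Real.sqrt_le_sqrt (by linarith)
    refine h1.trans ?_
    have h4 := Real.sqrt_pos.2 hpos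
    have h5 : 24 * (ε + t * (√(sqSum w I) / √(sqSum w S))) =
        12 * (2 * (ε * √(sqSum w S) + t * √(sqSum w I)) / √(sqSum w S)) := by
      field_simp
      norm_num
    rw [h5]
    refine mul_le_mul_of_nonneg_left ?_ (by norm_num)
    rw [div_le_div_iff₀ h4 hS1]
    nlinarith

end HeadTail

/-! ### Balancedness under a random restriction -/

section Restriction

/-- The expectation of a square root is at most the square root of the expectation. -/
lemma sum_toReal_mul_sqrt_le {α : Type*} [Fintype α] (μ : PMF α) {X : α → ℝ} (hX : ∀ a, 0 ≤ X a) :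
    ∑ a, (μ a).toReal * √(X a) ≤ √(∑ a, (μ a).toReal * X a) := by
  have h := Real.sum_sqrt_mul_sqrt_le univ (f := fun a => (μ a).toReal)
    (g := fun a => (μ a).toReal * X a) (fun _ => ENNReal.toReal_nonneg)
    (fun a => mul_nonneg ENNReal.toReal_nonneg (hX a))
  rw [sum_toReal, Real.sqrt_one, one_mul] at h
  refine le_trans (le_of_eq (sum_congr rfl fun a _ => ?_)) h
  rw [Real.sqrt_mul ENNReal.toReal_nonneg, ← mul_assoc, Real.mul_self_sqrt ENNReal.toReal_nonneg]

variable {n q : ℕ}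

/-- The set of variables which `y` keeps alive. -/
def alive (y : Fin n × Fin q → ℤˣ) : Finset (Fin n) := univ.filter fun i => ∀ j, y (i, j) = 1

lemma mem_alive {y : Fin n × Fin q → ℤˣ} {i : Fin n} : i ∈ alive y ↔ ∀ j, y (i, j) = 1 := by
  simp [alive]

/-- A block has `q ≤ k` bits: `p` is its uniform probability and `2p` the error of almost
independence. -/
lemma prob_mem_alive_le {p : ℝ} {k : ℕ} (hp : p = 1 / 2 ^ q) (hk : q ≤ k)
    {y : PMF (Fin n × Fin q → ℤˣ)} (hy : AlmostWiseIndep p k y) (i : Fin n) :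
    prob y {a | i ∈ alive a} ≤ 3 * p := by
  have h := hy.prob_forall_eq_one_le ({i} ×ˢ univ) (by simpa using hk)
  have h1 : {a : Fin n × Fin q → ℤˣ | i ∈ alive a} =
      {x | ∀ j ∈ ({i} ×ˢ univ : Finset (Fin n × Fin q)), x j = 1} := by
    ext a
    simp [mem_alive]
  rw [h1]
  simp only [card_product, card_singleton, card_univ, Fintype.card_fin, one_mul, ← hp] at h
  linarith

lemma balanced_restrict_iff (Φ : LTF (Fin n)) (t : ℝ) (a : Fin n × Fin q → ℤˣ)
    (b : Fin n → ℤˣ) : (Φ.restrict (toRestriction a b)).Balanced t ↔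
      |dot (zeroOn Φ.w (alive a)) b - Φ.θ| ≤ t * √(sqSum Φ.w (alive a)) := by
  have h1 : ∑ i, fixedTerm (Φ.w i) (toRestriction a b i) = dot (zeroOn Φ.w (alive a)) b := by
    refine sum_congr rfl fun i _ => ?_
    rw [zeroOn_apply, toRestriction]
    by_cases h : ∀ j, a (i, j) = 1
    · rw [if_pos h, if_pos (mem_alive.2 h), zero_mul, fixedTerm]
    · rw [if_neg h, if_neg fun h' => h (mem_alive.1 h'), fixedTerm]
  have h2 : ‖(Φ.restrict (toRestriction a b)).w‖ = √(sqSum Φ.w (alive a)) := by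
    have h : ∀ i, i ∈ alive a ↔ toRestriction a b i = none := by
      intro i
      simp only [mem_alive, toRestriction]
      split_ifs with h <;> simp [h]
    rw [EuclideanSpace.norm_eq, sqSum, Finset.sum_subtype (alive a) h fun i => Φ.w i ^ 2]
    simp only [Real.norm_eq_abs, sq_abs]
    rfl
  rw [LTF.Balanced, h2, abs_sub_comm, ← h1]
  rfl

/-- Passing from `z` to uniformly random fixed values. -/
lemma prob_balanced_le {δ t : ℝ} (ht : 0 < t) {z : PMF (Fin n → ℤˣ)}
    (hz : PseudorandomlyConcentrated δ z) (Φ : LTF (Fin n)) (a : Fin n × Fin q → ℤˣ)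
    (hI : 0 < sqSum Φ.w (alive a)) :
    prob z {b | (Φ.restrict (toRestriction a b)).Balanced t} ≤ prob (unif (Fin n))
      {x | |dot (zeroOn Φ.w (alive a)) x - Φ.θ| ≤ t * √(sqSum Φ.w (alive a))} + δ := by
  set R := t * √(sqSum Φ.w (alive a)) with hR
  have hR0 : 0 < R := mul_pos ht (Real.sqrt_pos.2 hI)
  have h := hz (zeroOn Φ.w (alive a)) (Φ.θ - R) (Φ.θ + R) (by linarith)
  have h1 : ∀ x : Fin n → ℤˣ, dot (zeroOn Φ.w (alive a)) x ∈ Set.Icc (Φ.θ - R) (Φ.θ + R) ↔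
      |dot (zeroOn Φ.w (alive a)) x - Φ.θ| ≤ R := by
    intro x
    rw [Set.mem_Icc, abs_le]
    constructor <;> rintro ⟨h1, h2⟩ <;> constructor <;> linarith
  simp_rw [h1] at h
  simp_rw [balanced_restrict_iff, ← hR]
  linarith [(abs_le.1 h).2]

/-- When the alive weights vanish, the interval around `θ` degenerates to a point, which
pseudorandom concentration does not cover; nondegeneracy says it is never hit. -/
lemma prob_balanced_eq_zero {t : ℝ} (z : PMF (Fin n → ℤˣ)) {Φ : LTF (Fin n)}
    (hΦ : Φ.Nondegenerate) (a : Fin n × Fin q → ℤˣ) (hI : sqSum Φ.w (alive a) = 0) :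
    prob z {b | (Φ.restrict (toRestriction a b)).Balanced t} = 0 := by
  have h : {b | (Φ.restrict (toRestriction a b)).Balanced t} = ∅ := by
    ext b
    simp only [Set.mem_ofPred_eq, Set.mem_empty_iff_false, iff_false]
    rw [balanced_restrict_iff, hI, Real.sqrt_zero, mul_zero, abs_nonpos_iff, sub_eq_zero]
    have h1 : dot (zeroOn Φ.w (alive a)) b = dot Φ.w b := by
      refine sum_congr rfl fun i _ => ?_
      rw [zeroOn_apply]
      split_ifs with hi
      · have := (sum_eq_zero_iff_of_nonneg fun _ _ => sq_nonneg _).1 hI i hi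
        rw [pow_eq_zero_iff two_ne_zero] at this
        rw [this]
      · rfl
    rw [h1]
    exact hΦ b
  rw [h, prob_eq_sum]
  simp

/-- The bound on the probability of balancedness for general parameters: `ε` is the regularity,
`r` the number of rounds, `m` the number of coordinates removed in each of them. -/
lemma prob_restrictionDist_balanced_le {p t ε δ : ℝ} {k m r : ℕ} (hp : p = 1 / 2 ^ q)
    (hk : q ≤ k) (ht : 1 ≤ t) (hε : 0 ≤ ε) (hε1 : ε ≤ 1) (hδ : 0 ≤ δ)
    (hm : 4 * t ^ 2 * (1 - ε ^ 2) ^ m ≤ ε ^ 2)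
    {y : PMF (Fin n × Fin q → ℤˣ)} {z : PMF (Fin n → ℤˣ)}
    (hy : AlmostWiseIndep p k y) (hz : PseudorandomlyConcentrated δ z)
    {Φ : LTF (Fin n)} (hΦ : Φ.Nondegenerate) :
    prob (restrictionDist y z) {ρ | (Φ.restrict ρ).Balanced t} ≤
      3 * p * (r * (m + 1)) + 24 * t * √(3 * p) + ((1 / 2) ^ r + 24 * ε + δ) := by
  have hp0 : 0 ≤ p := by rw [hp]; positivity
  obtain ⟨S, hcard, hS⟩ := exists_head_tail Φ.w (e := ε ^ 2) (pow_le_one₀ hε hε1) ht hm r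
  set V := sqSum Φ.w S with hV
  have hpoint : ∀ a : Fin n × Fin q → ℤˣ,
      prob z {b | (Φ.restrict (toRestriction a b)).Balanced t} ≤
        ∑ i ∈ Sᶜ, (if i ∈ alive a then (1 : ℝ) else 0) +
          24 * t / √V * √(sqSum Φ.w (S ∩ alive a)) + ((1 / 2) ^ r + 24 * ε + δ) := by
    intro a
    have hA : 0 ≤ ∑ i ∈ Sᶜ, (if i ∈ alive a then (1 : ℝ) else 0) :=
      sum_nonneg fun i _ => by split_ifs <;> simp
    have hB : 0 ≤ 24 * t / √V * √(sqSum Φ.w (S ∩ alive a)) := by positivity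
    have hC : (0 : ℝ) ≤ (1 / 2) ^ r := by positivity
    rcases (sqSum_nonneg Φ.w (alive a)).eq_or_lt with hI | hI
    · rw [prob_balanced_eq_zero z hΦ a hI.symm]
      positivity
    by_cases hsub : alive a ⊆ S
    · have h1 := prob_balanced_le (by linarith : 0 < t) hz Φ a hI
      rw [inter_eq_right.2 hsub] at hB ⊢
      rcases hS with hS | hS
      · have h2 := prob_unif_zeroOn_le_of_regular Φ.w hε ht hS hsub hI Φ.θ
        have h3 : 24 * t / √V * √(sqSum Φ.w (alive a)) =
            24 * (t * (√(sqSum Φ.w (alive a)) / √V)) := by ring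
        rw [h3]
        linarith
      · have h2 := hS (zeroOn Φ.w (alive a)) (fun i hi => by
          rw [zeroOn_apply, if_neg fun h => hi (hsub h)]) Φ.θ
          (t * √(sqSum Φ.w (alive a))) (by
            have h4 := Real.sqrt_le_sqrt (sqSum_mono Φ.w hsub)
            have h5 := Real.sqrt_nonneg (sqSum Φ.w (alive a))
            nlinarith)
        linarith
    -- An alive head coordinate makes the first sum at least 1, so the bound is trivial.
    · obtain ⟨i, hi, hiS⟩ := not_subset.1 hsub
      have h1 : (1 : ℝ) ≤ ∑ i ∈ Sᶜ, (if i ∈ alive a then (1 : ℝ) else 0) := by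
        refine le_trans (by rw [if_pos (by exact hi)]) (single_le_sum
          (f := fun i => if i ∈ alive a then (1 : ℝ) else 0)
          (fun i _ => by split_ifs <;> simp) (mem_compl.2 hiS))
      linarith [prob_le_one z {b | (Φ.restrict (toRestriction a b)).Balanced t}]
  have hhead : ∑ a, (y a).toReal * ∑ i ∈ Sᶜ, (if i ∈ alive a then (1 : ℝ) else 0) ≤
      3 * p * (r * (m + 1)) := by
    simp_rw [mul_sum]
    rw [sum_comm]
    calc _ = ∑ i ∈ Sᶜ, prob y {a | i ∈ alive a} := by
          refine sum_congr rfl fun i _ => ?_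
          rw [prob_eq_sum]
          refine sum_congr rfl fun a _ => ?_
          by_cases h : i ∈ alive a <;> simp [h]
      _ ≤ ∑ i ∈ Sᶜ, 3 * p := sum_le_sum fun i _ => prob_mem_alive_le hp hk hy i
      _ = 3 * p * Sᶜ.card := by rw [sum_const, nsmul_eq_mul, mul_comm]
      _ ≤ 3 * p * (r * (m + 1)) := by
          gcongr
          exact_mod_cast hcard
  have hmean : ∑ a, (y a).toReal * sqSum Φ.w (S ∩ alive a) ≤ 3 * p * V := by
    have h1 : ∀ a : Fin n × Fin q → ℤˣ, sqSum Φ.w (S ∩ alive a) =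
        ∑ i ∈ S, if i ∈ alive a then Φ.w i ^ 2 else 0 := by
      intro a
      rw [sqSum, ← filter_mem_eq_inter, sum_filter]
    simp_rw [h1, mul_sum]
    rw [sum_comm, hV, sqSum, mul_sum]
    refine sum_le_sum fun i _ => ?_
    calc _ = prob y {a | i ∈ alive a} * Φ.w i ^ 2 := by
          rw [prob_eq_sum, sum_mul]
          refine sum_congr rfl fun a _ => ?_
          by_cases h : i ∈ alive a <;> simp [h]
      _ ≤ _ := mul_le_mul_of_nonneg_right (prob_mem_alive_le hp hk hy i) (sq_nonneg _)
  have htail : ∑ a, (y a).toReal * (24 * t / √V * √(sqSum Φ.w (S ∩ alive a))) ≤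
      24 * t * √(3 * p) := by
    calc _ = 24 * t / √V * ∑ a, (y a).toReal * √(sqSum Φ.w (S ∩ alive a)) := by
          rw [mul_sum]
          exact sum_congr rfl fun a _ => by ring
      _ ≤ 24 * t / √V * √(3 * p * V) := by
          gcongr
          exact (sum_toReal_mul_sqrt_le y fun a => sqSum_nonneg _ _).trans
            (Real.sqrt_le_sqrt hmean)
      _ = 24 * t * √(3 * p) * (√V / √V) := by
          rw [Real.sqrt_mul (by positivity)]
          ring
      -- An inequality, because `V` may be 0 and then `√V / √V = 0`.
      _ ≤ 24 * t * √(3 * p) := mul_le_of_le_one_right (by positivity) (div_self_le_one _)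
  rw [restrictionDist, prob_bind_map]
  calc _ ≤ ∑ a, (y a).toReal * (∑ i ∈ Sᶜ, (if i ∈ alive a then (1 : ℝ) else 0) +
          24 * t / √V * √(sqSum Φ.w (S ∩ alive a)) + ((1 / 2) ^ r + 24 * ε + δ)) :=
        sum_le_sum fun a _ => mul_le_mul_of_nonneg_left (hpoint a) ENNReal.toReal_nonneg
    _ ≤ _ := by
        simp only [mul_add (_ : ENNReal).toReal, sum_add_distrib, ← sum_mul, sum_toReal]
        linarith

end Restriction

/-! ### Choice of parameters -/

section Parameters

/-- Enough coordinates to remove in each round. -/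
lemma exists_numRemovals (c : ℕ) {t : ℝ} (ht : 1 ≤ t) : ∃ m : ℕ,
    4 * t ^ 2 * (1 - ((t ^ c)⁻¹) ^ 2) ^ m ≤ ((t ^ c)⁻¹) ^ 2 ∧
      (m : ℝ) + 1 ≤ (2 * c + 6) * Real.log (t + 2) * t ^ (2 * c) := by
  have ht0 : 0 < t := by linarith
  set e := ((t ^ c)⁻¹) ^ 2 with he
  have he0 : 0 < e := by positivity
  have hT : 1 ≤ t ^ (2 * c) := one_le_pow₀ ht
  have he' : e⁻¹ = t ^ (2 * c) := by rw [he, inv_pow, inv_inv, ← pow_mul, mul_comm]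
  have he1 : e ≤ 1 := by
    rw [← inv_inv e, he']
    exact inv_le_one_of_one_le₀ hT
  have hL : 1 ≤ Real.log (t + 2) := by
    rw [Real.le_log_iff_exp_le (by linarith)]
    linarith [Real.exp_one_lt_three]
  have hlt : Real.log t ≤ Real.log (t + 2) := Real.log_le_log ht0 (by linarith)
  have hX : Real.log (4 * t ^ 2 * t ^ (2 * c)) ≤ (2 * c + 4) * Real.log (t + 2) := by
    rw [Real.log_mul (by positivity) (by positivity), Real.log_mul (by norm_num) (by positivity),
      Real.log_pow, Real.log_pow]
    have h4 : Real.log 4 ≤ 2 := by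
      rw [show (4 : ℝ) = 2 ^ 2 by norm_num, Real.log_pow]
      have := Real.log_two_lt_d9
      push_cast
      linarith
    push_cast
    have : (c : ℝ) * Real.log t ≤ c * Real.log (t + 2) := by gcongr
    linarith
  have hX0 : 0 ≤ Real.log (4 * t ^ 2 * t ^ (2 * c)) :=
    Real.log_nonneg (one_le_mul_of_one_le_of_one_le (by nlinarith) hT)
  -- Since `t^{2c} = 1/e`, this is `log(4t²/e)/e` rounded up, and `(1 - e)^m ≤ exp(-em)`.
  refine ⟨⌈Real.log (4 * t ^ 2 * t ^ (2 * c)) * t ^ (2 * c)⌉₊, ?_, ?_⟩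
  · set m := ⌈Real.log (4 * t ^ 2 * t ^ (2 * c)) * t ^ (2 * c)⌉₊
    have hm : Real.log (4 * t ^ 2 * t ^ (2 * c)) * t ^ (2 * c) ≤ m := Nat.le_ceil _
    have h1 : (1 - e) ^ m ≤ Real.exp (-Real.log (4 * t ^ 2 * t ^ (2 * c))) := by
      calc (1 - e) ^ m ≤ Real.exp (-e) ^ m := by
            have := sub_nonneg.2 he1
            gcongr
            exact Real.one_sub_le_exp_neg e
        _ = Real.exp (-(m * e)) := by rw [← Real.exp_nat_mul]; ring_nf
        _ ≤ _ := by
            rw [Real.exp_le_exp, neg_le_neg_iff, ← div_le_iff₀ he0, div_eq_mul_inv, he']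
            exact hm
    rw [Real.exp_neg, Real.exp_log (by positivity)] at h1
    calc 4 * t ^ 2 * (1 - e) ^ m ≤ 4 * t ^ 2 * (4 * t ^ 2 * t ^ (2 * c))⁻¹ := by gcongr
      _ = e := by rw [← he']; field_simp
  · have h1 := (Nat.ceil_lt_add_one (mul_nonneg hX0 (by positivity : 0 ≤ t ^ (2 * c)))).le
    have h2 := mul_le_mul_of_nonneg_right hX (by positivity : 0 ≤ t ^ (2 * c))
    have h3 : 1 ≤ Real.log (t + 2) * t ^ (2 * c) := one_le_mul_of_one_le_of_one_le hL hT
    linarith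

/-- Enough rounds. -/
lemma exists_numRounds (c : ℕ) {t : ℝ} (ht : 1 ≤ t) : ∃ r : ℕ,
    (1 / 2 : ℝ) ^ r ≤ (t ^ c)⁻¹ ∧ (r : ℝ) ≤ (2 * c + 1) * Real.log (t + 2) := by
  have ht0 : 0 < t := by linarith
  have hL : 1 ≤ Real.log (t + 2) := by
    rw [Real.le_log_iff_exp_le (by linarith)]
    linarith [Real.exp_one_lt_three]
  have hlt : Real.log t ≤ Real.log (t + 2) := Real.log_le_log ht0 (by linarith)
  have hl0 := Real.log_nonneg ht
  have hl2 : 1 / 2 ≤ Real.log 2 := by linarith [Real.log_two_gt_d9]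
  -- The 2 compensates for using only `log 2 ≥ 1/2`.
  refine ⟨⌈2 * (c * Real.log t)⌉₊, ?_, ?_⟩
  · set r := ⌈2 * (c * Real.log t)⌉₊
    have hr : 2 * (c * Real.log t) ≤ r := Nat.le_ceil _
    rw [one_div, inv_pow]
    refine inv_anti₀ (by positivity) ?_
    rw [← Real.log_le_log_iff (by positivity) (by positivity), Real.log_pow, Real.log_pow]
    nlinarith [Nat.cast_nonneg (α := ℝ) r]
  · have h1 := (Nat.ceil_lt_add_one (by positivity : 0 ≤ 2 * (c * Real.log t))).le
    have : (c : ℝ) * Real.log t ≤ c * Real.log (t + 2) := by gcongr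
    linarith

/-- The exponent `3c - 2` comes from `2c = (1 + c/2) + (3c - 2)/2`: the bound on `t` says exactly
that `t^{(3c-2)/2} ≤ p^{-1/2}`. -/
lemma mul_pow_le_rpow_mul_sqrt {c : ℕ} (hc : 1 ≤ c) {p t : ℝ} (hp : 0 < p) (ht : 0 < t)
    (htp : t ≤ p ^ (-1 / (3 * (c : ℝ) - 2))) :
    p * t ^ (2 * c) ≤ t ^ (1 + (c : ℝ) / 2) * √p := by
  have hc' : (1 : ℝ) ≤ c := by exact_mod_cast hc
  have hd : 0 < 3 * (c : ℝ) - 2 := by linarith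
  have h1 : t ^ ((3 * (c : ℝ) - 2) / 2) ≤ p ^ (-1 / 2 : ℝ) := by
    refine (Real.rpow_le_rpow ht.le htp (by positivity)).trans (le_of_eq ?_)
    rw [← Real.rpow_mul hp.le]
    congr 1
    field_simp
  have h2 : t ^ (2 * c) = t ^ (1 + (c : ℝ) / 2) * t ^ ((3 * (c : ℝ) - 2) / 2) := by
    rw [← Real.rpow_add ht, ← Real.rpow_natCast]
    congr 1
    push_cast
    ring
  have h3 : √p = p * p ^ (-1 / 2 : ℝ) := by
    rw [Real.sqrt_eq_rpow]
    nth_rewrite 2 [← Real.rpow_one p]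
    rw [← Real.rpow_add hp]
    norm_num
  rw [h2, h3]
  calc _ = t ^ (1 + (c : ℝ) / 2) * (p * t ^ ((3 * (c : ℝ) - 2) / 2)) := by ring
    _ ≤ _ := by gcongr

end Parameters

end LTFRestriction

theorem mainTheorem6 (c : ℕ) :
    ∃ C₁ C₂ : ℝ, ∃ K : ℕ, 0 < C₁ ∧ 0 < C₂ ∧
      ∀ (n q k : ℕ) (p t : ℝ),
        p = 1 / 2 ^ q → q ≤ k →
        0 < t → t ≤ p ^ (-1 / (3 * (c : ℝ) - 2)) →
        ∀ (y : PMF (Fin n × Fin q → ℤˣ)) (z : PMF (Fin n → ℤˣ)),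
          LTFRestriction.AlmostWiseIndep p k y →
          LTFRestriction.PseudorandomlyConcentrated (1 / (4 * t ^ c)) z →
          ∀ Φ : LTFRestriction.LTF (Fin n), Φ.Nondegenerate →
            LTFRestriction.prob (LTFRestriction.restrictionDist y z)
                {ρ | (Φ.restrict ρ).Balanced t}
              ≤ C₁ * t ^ (1 + (c : ℝ) / 2) * Real.log (t + 2) ^ K * Real.sqrt p
                + C₂ * (t ^ c)⁻¹ := by
  -- The head gives the product and the tail 48; `26` covers `1 + 24 + 1/4`. The two logarithms come
  -- from `r` and `m`.
  refine ⟨3 * ((2 * c + 1) * (2 * c + 6)) + 48, 26, 2, by positivity, by norm_num, ?_⟩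
  intro n q k p t hp hk ht htp y z hy hz Φ hΦ
  have hp0 : 0 < p := by rw [hp]; positivity
  have hfirst : 0 ≤ (3 * ((2 * (c : ℝ) + 1) * (2 * c + 6)) + 48) * t ^ (1 + (c : ℝ) / 2) *
      Real.log (t + 2) ^ 2 * √p := by positivity
  -- Here the second term already exceeds 1. This disposes of `c = 0` and of `t < 1`.
  by_cases htriv : t ^ c ≤ 1
  · have h1 : 1 ≤ (t ^ c)⁻¹ := (one_le_inv₀ (by positivity)).2 htriv
    linarith [LTFRestriction.prob_le_one (LTFRestriction.restrictionDist y z)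
      {ρ | (Φ.restrict ρ).Balanced t}]
  have hc : 1 ≤ c := by
    by_contra h
    exact htriv (by simp [show c = 0 by omega])
  have ht1 : 1 ≤ t := by
    by_contra h
    exact htriv (pow_le_one₀ ht.le (not_le.1 h).le)
  obtain ⟨m, hm, hm'⟩ := LTFRestriction.exists_numRemovals c ht1
  obtain ⟨r, hr, hr'⟩ := LTFRestriction.exists_numRounds c ht1
  -- Unifying with `hm` sets `ε = (t ^ c)⁻¹`.
  have hmain := LTFRestriction.prob_restrictionDist_balanced_le (r := r) hp hk ht1
    (by positivity) (inv_le_one_of_one_le₀ (one_le_pow₀ ht1)) (by positivity) hm hy hz hΦ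
  refine hmain.trans ?_
  set L := Real.log (t + 2) with hLdef
  have hL : 1 ≤ L := by
    rw [hLdef, Real.le_log_iff_exp_le (by linarith)]
    linarith [Real.exp_one_lt_three]
  have hhead : 3 * p * (r * (m + 1)) ≤
      3 * ((2 * c + 1) * (2 * c + 6)) * (t ^ (1 + (c : ℝ) / 2) * L ^ 2 * √p) := by
    calc 3 * p * (r * (m + 1))
        ≤ 3 * p * (((2 * c + 1) * L) * ((2 * c + 6) * L * t ^ (2 * c))) := by gcongr
      _ = 3 * ((2 * c + 1) * (2 * c + 6)) * L ^ 2 * (p * t ^ (2 * c)) := by ring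
      _ ≤ 3 * ((2 * c + 1) * (2 * c + 6)) * L ^ 2 * (t ^ (1 + (c : ℝ) / 2) * √p) := by
          exact mul_le_mul_of_nonneg_left
            (LTFRestriction.mul_pow_le_rpow_mul_sqrt hc hp0 ht htp) (by positivity)
      _ = _ := by ring
  have htail : 24 * t * √(3 * p) ≤ 48 * (t ^ (1 + (c : ℝ) / 2) * L ^ 2 * √p) := by
    have h1 : t ≤ t ^ (1 + (c : ℝ) / 2) := by
      nth_rewrite 1 [← Real.rpow_one t]
      exact Real.rpow_le_rpow_of_exponent_le ht1 (by linarith [Nat.cast_nonneg (α := ℝ) c])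
    have h2 : √(3 * p) ≤ 2 * √p := by
      rw [Real.sqrt_mul (by norm_num)]
      gcongr
      rw [Real.sqrt_le_left (by norm_num)]
      norm_num
    calc 24 * t * √(3 * p) ≤ 24 * t ^ (1 + (c : ℝ) / 2) * (2 * √p) := by gcongr
      _ = 48 * (t ^ (1 + (c : ℝ) / 2) * 1 * √p) := by ring
      _ ≤ _ := by
          gcongr
          exact one_le_pow₀ hL
  have hδ : 1 / (4 * t ^ c) = (t ^ c)⁻¹ / 4 := by
    field_simp
  have hinv : 0 ≤ (t ^ c)⁻¹ := by positivity
  rw [hδ]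
  linarith
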